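/- Let $\tau\in\mathbb{C}$ with $\operatorname{Im}\tau>0$, let $\Lambda=\mathbb{Z}+\tau\mathbb{Z}$, and let $$\theta_1(u)=\theta_1(u\mid\tau)=-\sum_{n=-\infty}^{\infty}\exp\Bigl(\pi i\tau\bigl(n+\tfrac12\bigr)^2+2\pi i\bigl(n+\tfrac12\bigr)\bigl(u+\tfrac12\bigr)\Bigr)$$ be Jacobi's theta function, with $\theta_1'$ its $u$-derivative. Let $\wp(u)=\wp(u\mid 1,\tau)$ be the Weierstrass function with primitive periods $1$ and $\tau$, $$\wp(u)=\frac1{u^2}+\sum_{(m,n)\neq(0,0)}\Bigl(\frac1{(u+m+n\tau)^2}-\frac1{(m+n\tau)^2}\Bigr).$$ For $u,z\in\mathbb{C}\setminus\Lambda$ put $$x(u,z)=x(u,z\mid\tau)=\frac{\theta_1(z-u)\,\theta_1'(0)}{\theta_1(z)\,\theta_1(u)},\qquad y(u,z)=\frac{\partial x(u,z)}{\partial u}.$$ Then: 1. $x(u,z)\,y(v,z)-y(u,z)\,x(v,z)=x(u+v,z)\bigl(\wp(u)-\wp(v)\bigr)$ for all $u,v,z\in\mathbb{C}$ with $u,v,u+v,z\notin\Lambda$;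 2. $x(u,z)\,y(-u,z)-y(u,z)\,x(-u,z)=\wp'(u)$ for all $u,z\in\mathbb{C}\setminus\Lambda$, where $y(-u,z)$ is the value of the function $y$ at $(-u,z)$; 3. $x(u,z)\,x(-u,z)=\wp(z)-\wp(u)$ for all $u,z\in\mathbb{C}\setminus\Lambda$; 4. for all $u,z\in\mathbb{C}\setminus\Lambda$, the (complex) derivatives $\partial x/\partial u$, $\partial x/\partial z$, $\partial x/\partial\tau$ and $\partial^2x/\partial u\,\partial z$ exist and $$2\pi i\,\frac{\partial x(u,z)}{\partial\tau}+\frac{\partial^2x(u,z)}{\partial u\,\partial z}=0.$$ -/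

import Mathlib

namespace CalogeroKernel

noncomputable section

/-- The period pair `(1, τ)`, for `τ` in the upper half plane. -/
def periods (τ : ℂ) (hτ : 0 < τ.im) : PeriodPair where
  ω₁ := 1
  ω₂ := τ
  indep := by
    rw [LinearIndependent.pair_iff]
    intro s t h
    have him := congrArg Complex.im h
    have hre := congrArg Complex.re h
    simp only [Complex.add_im, Complex.smul_im, Complex.one_im, smul_eq_mul, mul_zero, zero_add,
      Complex.zero_im, mul_eq_zero, hτ.ne', or_false] at him
    subst him
    simpa using hre

/-- Jacobi's theta function `θ₁(u | τ)`. -/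
def theta₁ (u τ : ℂ) : ℂ :=
  -∑' n : ℤ, Complex.exp (Real.pi * Complex.I * τ * ((n : ℂ) + 1 / 2) ^ 2
    + 2 * Real.pi * Complex.I * ((n : ℂ) + 1 / 2) * (u + 1 / 2))

/-- The kernel `x(u, z) = θ₁(z - u) θ₁'(0) / (θ₁(z) θ₁(u))`, as a function of `u`, `z` and `τ`. -/
def x (u z τ : ℂ) : ℂ :=
  theta₁ (z - u) τ * deriv (fun w => theta₁ w τ) 0 / (theta₁ z τ * theta₁ u τ)

/-- The partial derivative `y(u, z) = ∂x(u, z)/∂u`. -/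
def y (u z τ : ℂ) : ℂ :=
  deriv (fun w => x w z τ) u

end

end CalogeroKernel

/-! Write θ for θ₁. Everything rests on one addition formula, θ'(0)² θ(u+a) θ(u-a) = θ(u)² θ(a)²
(℘(a) - ℘(u)), proved as `theta_add_mul_theta_sub`. As functions of u, θ², θ²℘ and θ(u+a)θ(u-a)
extend to entire functions with the same multipliers under 1 and τ. These multipliers tie the
Fourier coefficients n and n+2 together, so such functions span at most two dimensions
(`exists_linear_relation`); evaluating the resulting relation at u = 0 and u = a determines it. The
formula also shows that θ vanishes only on Λ.

Identity 3 is this formula, and identity 2 is the u-derivative of identity 3. The formula exhibits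
θ(x+y)θ(x-y) as a 2×2 minor, so a Plücker relation yields the three-term relation of Weierstrass;
one derivative of that is identity 1 cleared of denominators (`theta_log_deriv_relation`). Two
further derivatives at v = 0 give `theta_second_order_relation`, which becomes identity 4 once ∂θ/∂τ
= θ''/(4πi) has replaced the τ-derivatives. -/

namespace CalogeroKernel

open Complex Filter Topology

/-! ### The theta series and its termwise derivatives -/

/-- The `n`-th term of the series for the `k`-th `u`-derivative of `-θ₁(u | τ)`. -/
noncomputable def thetaTerm (k : ℕ) (n : ℤ) (u τ : ℂ) : ℂ :=
  (2 * Real.pi * I * ((n : ℂ) + 1 / 2)) ^ k *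
    cexp (Real.pi * I * τ * ((n : ℂ) + 1 / 2) ^ 2
      + 2 * Real.pi * I * ((n : ℂ) + 1 / 2) * (u + 1 / 2))

/-- The `k`-th `u`-derivative of `θ₁(u | τ)`, as a series. -/
noncomputable def thetaDeriv (k : ℕ) (u τ : ℂ) : ℂ := -∑' n : ℤ, thetaTerm k n u τ

lemma theta₁_eq_thetaDeriv (u τ : ℂ) : theta₁ u τ = thetaDeriv 0 u τ := by
  simp [theta₁, thetaDeriv, thetaTerm]

/-- A summable majorant of the terms of the theta series on a horizontal strip. -/
noncomputable def thetaBound (k : ℕ) (S T : ℝ) (n : ℤ) : ℝ :=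
  (2 * Real.pi * (|(n : ℝ)| + 1)) ^ k * (Real.exp (2 * Real.pi * S) *
    Real.exp (-Real.pi * (T * (n : ℝ) ^ 2 - 2 * (S + T / 2) * |(n : ℝ)|)))

lemma summable_thetaBound (k : ℕ) (S : ℝ) {T : ℝ} (hT : 0 < T) :
    Summable (thetaBound k S T) := by
  have h1 := summable_pow_mul_jacobiTheta₂_term_bound (S + T / 2) hT k
  have h0 := summable_pow_mul_jacobiTheta₂_term_bound (S + T / 2) hT 0
  refine Summable.of_nonneg_of_le (fun n => by unfold thetaBound; positivity) (fun n => ?_)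
    ((h1.add h0).mul_left ((2 * Real.pi) ^ k * Real.exp (2 * Real.pi * S) * 2 ^ (k - 1)))
  have h : (|(n : ℝ)| + 1) ^ k ≤ 2 ^ (k - 1) * (|(n : ℝ)| ^ k + 1 ^ k) :=
    add_pow_le (abs_nonneg _) zero_le_one k
  rw [thetaBound, mul_pow]
  have e : (0 : ℝ) ≤ (2 * Real.pi) ^ k * Real.exp (2 * Real.pi * S) *
    Real.exp (-Real.pi * (T * (n : ℝ) ^ 2 - 2 * (S + T / 2) * |(n : ℝ)|)) := by positivity
  have := mul_le_mul_of_nonneg_left h e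
  push_cast at this ⊢
  rw [one_pow] at this
  linarith

/-- The half-integer shift is absorbed by |n + 1/2| ≤ |n| + 1 and (n + 1/2)² ≥ n² - |n|. This is the
source of the factor exp(2πS) and of the shift T/2 in `thetaBound`. -/
lemma norm_thetaTerm_le (k : ℕ) (n : ℤ) {S T : ℝ} (hT : 0 < T) {u τ : ℂ}
    (hu : |u.im| ≤ S) (hτ : T ≤ τ.im) : ‖thetaTerm k n u τ‖ ≤ thetaBound k S T n := by
  have hm : |(n : ℝ) + 1 / 2| ≤ |(n : ℝ)| + 1 :=
    (abs_add_le _ _).trans (by norm_num [abs_of_pos])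
  have hS : 0 ≤ S := (abs_nonneg _).trans hu
  rw [thetaTerm, thetaBound, norm_mul, norm_pow, norm_exp, ← Real.exp_add]
  gcongr
  · have : (2 * Real.pi * I * ((n : ℂ) + 1 / 2)) = ((2 * Real.pi * ((n : ℝ) + 1 / 2) : ℝ) : ℂ) * I := by
      push_cast; ring
    rw [this, norm_mul, norm_I, mul_one, norm_real, Real.norm_eq_abs, abs_mul,
      abs_of_pos (by positivity : 0 < 2 * Real.pi)]
    gcongr
  · have : Real.pi * I * τ * ((n : ℂ) + 1 / 2) ^ 2
        + 2 * Real.pi * I * ((n : ℂ) + 1 / 2) * (u + 1 / 2) =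
        ((Real.pi * ((n : ℝ) + 1 / 2) ^ 2 : ℝ) : ℂ) * τ * I +
        ((2 * Real.pi * ((n : ℝ) + 1 / 2) : ℝ) : ℂ) * (u + ((1 / 2 : ℝ) : ℂ)) * I := by
      push_cast; ring
    rw [this, add_re, mul_I_re, mul_I_re, im_ofReal_mul, im_ofReal_mul, add_im, ofReal_im, add_zero]
    have h1 : -(((n : ℝ) + 1 / 2) * u.im) ≤ (|(n : ℝ)| + 1) * S := by
      calc -(((n : ℝ) + 1 / 2) * u.im) ≤ |((n : ℝ) + 1 / 2) * u.im| := neg_le_abs _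
        _ = |(n : ℝ) + 1 / 2| * |u.im| := abs_mul _ _
        _ ≤ _ := by gcongr
    have h2 : T * ((n : ℝ) ^ 2 - |(n : ℝ)|) ≤ ((n : ℝ) + 1 / 2) ^ 2 * τ.im := by
      calc T * ((n : ℝ) ^ 2 - |(n : ℝ)|) ≤ T * ((n : ℝ) + 1 / 2) ^ 2 := by
            gcongr
            nlinarith [neg_le_abs (n : ℝ)]
        _ ≤ τ.im * ((n : ℝ) + 1 / 2) ^ 2 := by gcongr
        _ = _ := mul_comm _ _
    nlinarith [mul_le_mul_of_nonneg_left h1 (by positivity : 0 ≤ 2 * Real.pi),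
      mul_le_mul_of_nonneg_left h2 Real.pi_pos.le]

lemma hasSum_thetaTerm (k : ℕ) (u : ℂ) {τ : ℂ} (hτ : 0 < τ.im) :
    HasSum (fun n => thetaTerm k n u τ) (-thetaDeriv k u τ) := by
  rw [thetaDeriv, neg_neg]
  exact (Summable.of_norm_bounded (summable_thetaBound k _ hτ)
    (fun n => norm_thetaTerm_le k n hτ le_rfl le_rfl)).hasSum

lemma hasDerivAt_thetaTerm_fst (k : ℕ) (n : ℤ) (u τ : ℂ) :
    HasDerivAt (fun w => thetaTerm k n w τ) (thetaTerm (k + 1) n u τ) u := by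
  have h := (((((hasDerivAt_id u).add_const (1 / 2 : ℂ)).const_mul
    (2 * Real.pi * I * ((n : ℂ) + 1 / 2))).const_add
    (Real.pi * I * τ * ((n : ℂ) + 1 / 2) ^ 2)).cexp).const_mul
    ((2 * Real.pi * I * ((n : ℂ) + 1 / 2)) ^ k)
  refine h.congr_deriv ?_
  simp only [thetaTerm, id]
  ring

/-- The heat equation term by term: with m = n + 1/2, πi m² = (2πi m)² / (4πi). -/
lemma hasDerivAt_thetaTerm_snd (k : ℕ) (n : ℤ) (u τ : ℂ) :
    HasDerivAt (fun t => thetaTerm k n u t) (thetaTerm (k + 2) n u τ / (4 * Real.pi * I)) τ := by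
  have h := (((((hasDerivAt_id τ).const_mul (Real.pi * I : ℂ)).mul_const
    (((n : ℂ) + 1 / 2) ^ 2)).add_const
    (2 * Real.pi * I * ((n : ℂ) + 1 / 2) * (u + 1 / 2))).cexp).const_mul
    ((2 * Real.pi * I * ((n : ℂ) + 1 / 2)) ^ k)
  refine h.congr_deriv ?_
  have hpi : (Real.pi : ℂ) ≠ 0 := ofReal_ne_zero.mpr Real.pi_ne_zero
  have hI := I_ne_zero
  simp only [thetaTerm, id]
  field_simp
  ring

lemma hasDerivAt_thetaDeriv_fst (k : ℕ) (u : ℂ) {τ : ℂ} (hτ : 0 < τ.im) :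
    HasDerivAt (fun w => thetaDeriv k w τ) (thetaDeriv (k + 1) u τ) u := by
  obtain ⟨S, hS⟩ := exists_gt |u.im|
  have hU : IsOpen {w : ℂ | |w.im| < S} :=
    isOpen_lt (continuous_abs.comp continuous_im) continuous_const
  have hd : ∀ n : ℤ, DifferentiableOn ℂ (fun w => thetaTerm k n w τ) {w : ℂ | |w.im| < S} :=
    fun n w _ => (hasDerivAt_thetaTerm_fst k n w τ).differentiableAt.differentiableWithinAt
  have hb : ∀ (n : ℤ) (w : ℂ), w ∈ {w : ℂ | |w.im| < S} →
      ‖thetaTerm k n w τ‖ ≤ thetaBound k S τ.im n :=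
    fun n w hw => norm_thetaTerm_le k n hτ (le_of_lt hw) le_rfl
  have h1 := differentiableOn_tsum_of_summable_norm (summable_thetaBound k S hτ) hd hU hb
  have h2 := hasSum_deriv_of_summable_norm (summable_thetaBound k S hτ) hd hU hb
    (show u ∈ {w : ℂ | |w.im| < S} from hS)
  simp only [fun n => (hasDerivAt_thetaTerm_fst k n u τ).deriv] at h2
  have h3 := (h1.differentiableAt (hU.mem_nhds hS)).hasDerivAt
  rw [h2.unique (hasSum_thetaTerm (k + 1) u hτ)] at h3
  exact h3.neg.congr_deriv (neg_neg _)

lemma hasDerivAt_thetaDeriv_snd (k : ℕ) (u : ℂ) {τ : ℂ} (hτ : 0 < τ.im) :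
    HasDerivAt (fun t => thetaDeriv k u t) (thetaDeriv (k + 2) u τ / (4 * Real.pi * I)) τ := by
  obtain ⟨T, hT, hTτ⟩ := exists_between hτ
  have hU : IsOpen {t : ℂ | T < t.im} := isOpen_lt continuous_const continuous_im
  have hd : ∀ n : ℤ, DifferentiableOn ℂ (fun t => thetaTerm k n u t) {t : ℂ | T < t.im} :=
    fun n t _ => (hasDerivAt_thetaTerm_snd k n u t).differentiableAt.differentiableWithinAt
  have hb : ∀ (n : ℤ) (t : ℂ), t ∈ {t : ℂ | T < t.im} →
      ‖thetaTerm k n u t‖ ≤ thetaBound k |u.im| T n :=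
    fun n t ht => norm_thetaTerm_le k n hT le_rfl (le_of_lt ht)
  have h1 := differentiableOn_tsum_of_summable_norm (summable_thetaBound k |u.im| hT) hd hU hb
  have h2 := hasSum_deriv_of_summable_norm (summable_thetaBound k |u.im| hT) hd hU hb
    (show τ ∈ {t : ℂ | T < t.im} from hTτ)
  simp only [fun n => (hasDerivAt_thetaTerm_snd k n u τ).deriv] at h2
  have h3 := (h1.differentiableAt (hU.mem_nhds hTτ)).hasDerivAt
  rw [h2.unique ((hasSum_thetaTerm (k + 2) u hτ).div_const _)] at h3
  refine h3.neg.congr_deriv ?_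
  ring

/-! ### Parity and quasi-periodicity of θ₁ -/

lemma exp_two_pi_I_half_int (n : ℤ) : cexp (2 * Real.pi * I * ((n : ℂ) + 1 / 2)) = -1 := by
  rw [show 2 * Real.pi * I * ((n : ℂ) + 1 / 2) = (n : ℂ) * (2 * Real.pi * I) + Real.pi * I by ring,
    exp_add, exp_int_mul_two_pi_mul_I, exp_pi_mul_I, one_mul]

lemma thetaDeriv_neg (k : ℕ) (u τ : ℂ) :
    thetaDeriv k (-u) τ = (-1) ^ (k + 1) * thetaDeriv k u τ := by
  rw [thetaDeriv, thetaDeriv, mul_neg, ← tsum_mul_left (a := (-1 : ℂ) ^ (k + 1)),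
    -- The substitution n ↦ -1 - n negates n + 1/2.
    ← (Equiv.subLeft (-1 : ℤ)).tsum_eq (fun n => thetaTerm k n (-u) τ)]
  congr 1
  refine tsum_congr fun n => ?_
  have e : Real.pi * I * τ * (((-1 - n : ℤ) : ℂ) + 1 / 2) ^ 2
      + 2 * Real.pi * I * (((-1 - n : ℤ) : ℂ) + 1 / 2) * (-u + 1 / 2) =
      (Real.pi * I * τ * ((n : ℂ) + 1 / 2) ^ 2
      + 2 * Real.pi * I * ((n : ℂ) + 1 / 2) * (u + 1 / 2)) - 2 * Real.pi * I * ((n : ℂ) + 1 / 2) := by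
    push_cast; ring
  have e2 : 2 * Real.pi * I * (((-1 - n : ℤ) : ℂ) + 1 / 2) =
      (-1) * (2 * Real.pi * I * ((n : ℂ) + 1 / 2)) := by push_cast; ring
  simp only [thetaTerm, Equiv.subLeft_apply]
  rw [e, exp_sub, exp_two_pi_I_half_int, e2, mul_pow, pow_succ]
  ring

lemma thetaDeriv_add_one (k : ℕ) (u τ : ℂ) : thetaDeriv k (u + 1) τ = -thetaDeriv k u τ := by
  rw [thetaDeriv, thetaDeriv, neg_neg, ← tsum_neg]
  refine tsum_congr fun n => ?_
  simp only [thetaTerm]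
  rw [show Real.pi * I * τ * ((n : ℂ) + 1 / 2) ^ 2
      + 2 * Real.pi * I * ((n : ℂ) + 1 / 2) * (u + 1 + 1 / 2) = (Real.pi * I * τ * ((n : ℂ) + 1 / 2) ^ 2
      + 2 * Real.pi * I * ((n : ℂ) + 1 / 2) * (u + 1 / 2)) + 2 * Real.pi * I * ((n : ℂ) + 1 / 2) by ring,
    exp_add, exp_two_pi_I_half_int]
  ring

lemma thetaDeriv_zero_add_tau (u τ : ℂ) : thetaDeriv 0 (u + τ) τ =
    -cexp (-(Real.pi * I * τ) - 2 * Real.pi * I * u) * thetaDeriv 0 u τ := by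
  rw [thetaDeriv, thetaDeriv, mul_neg,
    ← tsum_mul_left (a := -cexp (-(Real.pi * I * τ) - 2 * Real.pi * I * u)),
    ← (Equiv.addRight (1 : ℤ)).tsum_eq
      (fun n => -cexp (-(Real.pi * I * τ) - 2 * Real.pi * I * u) * thetaTerm 0 n u τ)]
  congr 1
  refine tsum_congr fun n => ?_
  simp only [thetaTerm, Equiv.coe_addRight, pow_zero, one_mul]
  rw [neg_mul, ← exp_add, ← neg_one_mul, ← exp_pi_mul_I, ← exp_add]
  -- The right-hand exponent is larger by 2πi: πi from writing the sign as an exponential, and πi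
  -- from the index shift acting on u + 1/2.
  refine exp_eq_exp_iff_exists_int.mpr ⟨-1, ?_⟩
  push_cast
  ring

lemma thetaDeriv_even_zero {k : ℕ} (hk : Even k) (τ : ℂ) : thetaDeriv k 0 τ = 0 := by
  have h := thetaDeriv_neg k 0 τ
  rw [neg_zero, (hk.add_one).neg_one_pow] at h
  linear_combination h / 2

/-! ### Fourier coefficients of periodic entire functions -/

/-- The integral of an entire function of period `1` over a horizontal period does not depend on
the base point. -/
lemma integral_add_eq_of_periodic {g : ℂ → ℂ} (hg : Differentiable ℂ g)
    (h1 : ∀ u, g (u + 1) = g u) (s : ℂ) :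
    ∫ x in (0 : ℝ)..1, g (x + s) = ∫ x in (0 : ℝ)..1, g x := by
  -- The ball is large enough for a primitive G to exist along all segments [w, w + 1] with ‖w‖ <
  -- ‖s‖ + 1; the integral is then G(1 + w) - G(w), whose derivative vanishes by periodicity.
  set r : ℝ := ‖s‖ + 2
  obtain ⟨G, hG⟩ := (hg.differentiableOn (s := Metric.ball 0 r)).isExactOn_ball
  have hr : ∀ w ∈ Metric.ball (0 : ℂ) (‖s‖ + 1), ∀ x ∈ Set.uIcc (0 : ℝ) 1,
      (x : ℂ) + w ∈ Metric.ball (0 : ℂ) r := by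
    intro w hw x hx
    rw [Set.uIcc_of_le zero_le_one] at hx
    rw [mem_ball_zero_iff] at hw ⊢
    calc ‖(x : ℂ) + w‖ ≤ ‖(x : ℂ)‖ + ‖w‖ := norm_add_le _ _
      _ < 1 + (‖s‖ + 1) := by
        refine add_lt_add_of_le_of_lt ?_ hw
        rw [norm_real, Real.norm_eq_abs, abs_of_nonneg hx.1]
        exact hx.2
      _ = r := by ring
  have key : ∀ w ∈ Metric.ball (0 : ℂ) (‖s‖ + 1),
      ∫ x in (0 : ℝ)..1, g (x + w) = G (1 + w) - G w := by
    intro w hw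
    have := intervalIntegral.integral_eq_sub_of_hasDerivAt (a := (0 : ℝ)) (b := 1)
      (f := fun x : ℝ => G (x + w)) (f' := fun x : ℝ => g (x + w)) (fun x hx => by
        have h := (hG _ (hr w hw x hx)).comp (x : ℂ) ((hasDerivAt_id (x : ℂ)).add_const w)
        simpa using h.comp_ofReal)
      ((hg.continuous.comp (by fun_prop)).intervalIntegrable _ _)
    simpa using this
  have hs : s ∈ Metric.ball (0 : ℂ) (‖s‖ + 1) := by simp
  have h0 : (0 : ℂ) ∈ Metric.ball (0 : ℂ) (‖s‖ + 1) := Metric.mem_ball_self (by positivity)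
  have hd : ∀ w ∈ Metric.ball (0 : ℂ) (‖s‖ + 1), HasDerivAt (fun w => G (1 + w) - G w) 0 w := by
    intro w hw
    have e1 := (hG _ (by simpa using hr w hw 1 (by simp))).comp w
      ((hasDerivAt_id w).const_add (1 : ℂ))
    have e0 := hG _ (by simpa using hr w hw 0 (by simp))
    refine (e1.sub e0).congr_deriv ?_
    simp [add_comm 1 w, h1]
  have hc := Metric.isOpen_ball.is_const_of_deriv_eq_zero (convex_ball (0 : ℂ) (‖s‖ + 1)).isPreconnected
    (fun w hw => (hd w hw).differentiableAt.differentiableWithinAt) (fun w hw => (hd w hw).deriv)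
    hs h0
  rw [key s hs]
  simpa using hc.trans (key 0 h0).symm

/-- The `n`-th Fourier coefficient of `f` along `[0, 1]`. -/
noncomputable def fourierInt (n : ℤ) (f : ℂ → ℂ) : ℂ :=
  ∫ x in (0 : ℝ)..1, cexp (-(2 * Real.pi * I * n * x)) * f x

/-- Zero coefficients are summable, so the Fourier series converges pointwise to f. -/
lemma continuous_integral_eq_zero {f : ℝ → ℂ} (hf : Continuous f) (h1 : ∀ x, f (x + 1) = f x)
    (h : ∀ n : ℤ, ∫ x in (0 : ℝ)..1, cexp (-(2 * Real.pi * I * n * x)) * f x = 0) (x : ℝ) :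
    f x = 0 := by
  have hper : Function.Periodic f (1 : ℝ) := h1
  obtain ⟨F, hFf⟩ : ∃ F : C(AddCircle (1 : ℝ), ℂ), ∀ x : ℝ, F (x : AddCircle (1 : ℝ)) = f x :=
    ⟨⟨hper.lift, continuous_coinduced_dom.mpr hf⟩, hper.lift_coe⟩
  have hF : fourierCoeff F = 0 := by
    ext n
    rw [fourierCoeff_eq_intervalIntegral _ n 0, zero_add, Pi.zero_apply, ← h n]
    simp only [div_one, one_smul]
    refine intervalIntegral.integral_congr fun x _ => ?_
    simp only [fourier_coe_apply, hFf, smul_eq_mul]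
    congr 2
    push_cast
    ring
  have hs := has_pointwise_sum_fourier_series_of_summable
    (f := F) (by rw [hF]; exact summable_zero) (x : AddCircle (1 : ℝ))
  simp only [hF, Pi.zero_apply, zero_smul, hFf] at hs
  exact hs.unique hasSum_zero

lemma exp_int_mul_periodic (n : ℤ) (u : ℂ) :
    cexp (-(2 * Real.pi * I * n * (u + 1))) = cexp (-(2 * Real.pi * I * n * u)) := by
  rw [exp_eq_exp_iff_exists_int]
  exact ⟨-n, by push_cast; ring⟩

lemma fourierInt_comp_add {f : ℂ → ℂ} (hf : Differentiable ℂ f) (h1 : ∀ u, f (u + 1) = f u)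
    (n : ℤ) (s : ℂ) : fourierInt n (fun u => f (u + s)) =
      cexp (2 * Real.pi * I * n * s) * fourierInt n f := by
  have h := integral_add_eq_of_periodic (g := fun u => cexp (-(2 * Real.pi * I * n * u)) * f u)
    (by fun_prop) (fun u => by rw [exp_int_mul_periodic, h1]) s
  rw [fourierInt, fourierInt, ← h, ← intervalIntegral.integral_const_mul]
  refine intervalIntegral.integral_congr fun x _ => ?_
  rw [← mul_assoc, ← exp_add]
  congr 2
  ring

lemma eq_zero_of_fourierInt_eq_zero {f : ℂ → ℂ} (hf : Differentiable ℂ f)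
    (h1 : ∀ u, f (u + 1) = f u) (h : ∀ n : ℤ, fourierInt n f = 0) (s : ℂ) : f s = 0 := by
  have := continuous_integral_eq_zero (f := fun x : ℝ => f (x + s))
    (hf.continuous.comp (by fun_prop))
    (fun x => by rw [← h1 (x + s)]; congr 1; push_cast; ring)
    (fun n => by
      have := fourierInt_comp_add hf h1 n s
      rw [h, mul_zero] at this
      exact this) 0
  simpa using this

/-! ### Quadratic theta functions -/

/-- Entire functions with the quasi-periodicity of `θ₁(u | τ)²`. -/
structure IsQuadraticTheta (τ : ℂ) (f : ℂ → ℂ) : Prop where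
  differentiable : Differentiable ℂ f
  add_one : ∀ u, f (u + 1) = f u
  add_tau : ∀ u, f (u + τ) = cexp (-(2 * Real.pi * I * τ) - 4 * Real.pi * I * u) * f u

namespace IsQuadraticTheta

variable {τ : ℂ} {f g h : ℂ → ℂ}

/-- Translation by τ scales the n-th coefficient by exp(2πi n τ), while the multiplier exp(-4πi u)
moves the index by two; all constants involved are nonzero. -/
lemma fourierInt_add_two (hf : IsQuadraticTheta τ f) (n : ℤ) :
    fourierInt n f = 0 ↔ fourierInt (n + 2) f = 0 := by
  have h := fourierInt_comp_add hf.differentiable hf.add_one n τ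
  have e : fourierInt n (fun u => f (u + τ)) =
      cexp (-(2 * Real.pi * I * τ)) * fourierInt (n + 2) f := by
    rw [fourierInt, fourierInt, ← intervalIntegral.integral_const_mul]
    refine intervalIntegral.integral_congr fun x _ => ?_
    simp only [hf.add_tau]
    rw [← mul_assoc, ← mul_assoc, ← exp_add, ← exp_add]
    congr 2
    push_cast
    ring
  rw [e] at h
  constructor <;> intro h0 <;> rw [h0, mul_zero] at h
  · exact (mul_eq_zero.mp h).resolve_left (exp_ne_zero _)
  · exact (mul_eq_zero.mp h.symm).resolve_left (exp_ne_zero _)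

lemma eq_zero (hf : IsQuadraticTheta τ f) (h0 : fourierInt 0 f = 0) (h1 : fourierInt 1 f = 0)
    (u : ℂ) : f u = 0 := by
  have key : ∀ n : ℤ, fourierInt n f = 0 ∧ fourierInt (n + 1) f = 0 := by
    intro n
    induction n using Int.induction_on with
    | zero => exact ⟨h0, by simpa using h1⟩
    | succ n ih => exact ⟨ih.2, by rw [add_assoc]; exact (hf.fourierInt_add_two _).mp ih.1⟩
    | pred n ih =>
      refine ⟨(hf.fourierInt_add_two _).mpr ?_, by rw [sub_add_cancel]; exact ih.1⟩
      rw [show -(n : ℤ) - 1 + 2 = -(n : ℤ) + 1 by ring]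
      exact ih.2
  exact eq_zero_of_fourierInt_eq_zero hf.differentiable hf.add_one (fun n => (key n).1) u

lemma fourierInt_linear (hf : IsQuadraticTheta τ f) (hg : IsQuadraticTheta τ g)
    (hh : IsQuadraticTheta τ h) (α β γ : ℂ) (n : ℤ) :
    fourierInt n (fun u => f u * α + g u * β + h u * γ) =
      fourierInt n f * α + fourierInt n g * β + fourierInt n h * γ := by
  have hi : ∀ {f : ℂ → ℂ} (c : ℂ), IsQuadraticTheta τ f → IntervalIntegrable
      (fun x : ℝ => cexp (-(2 * Real.pi * I * n * x)) * f x * c) MeasureTheory.volume 0 1 := by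
    intro f c hf
    have := hf.differentiable.continuous
    exact Continuous.intervalIntegrable (by fun_prop) _ _
  simp only [fourierInt]
  rw [← intervalIntegral.integral_mul_const, ← intervalIntegral.integral_mul_const,
    ← intervalIntegral.integral_mul_const, ← intervalIntegral.integral_add (hi α hf) (hi β hg),
    ← intervalIntegral.integral_add ((hi α hf).add (hi β hg)) (hi γ hh)]
  refine intervalIntegral.integral_congr fun x _ => ?_
  ring

/-- The space of quadratic theta functions has dimension at most two. -/
lemma exists_linear_relation (hf : IsQuadraticTheta τ f) (hg : IsQuadraticTheta τ g)
    (hh : IsQuadraticTheta τ h) : ∃ α β γ : ℂ, ¬(α = 0 ∧ β = 0 ∧ γ = 0) ∧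
      ∀ u, f u * α + g u * β + h u * γ = 0 := by
  -- The zero third row makes the matrix singular; a kernel vector is a combination whose
  -- coefficients 0 and 1 both vanish.
  obtain ⟨v, hv, hM⟩ := Matrix.exists_mulVec_eq_zero_iff.mpr
    (show (!![fourierInt 0 f, fourierInt 0 g, fourierInt 0 h;
      fourierInt 1 f, fourierInt 1 g, fourierInt 1 h; 0, 0, 0]).det = 0 by
      simp [Matrix.det_fin_three])
  have e0 := congrFun hM 0
  have e1 := congrFun hM 1
  simp only [Matrix.mulVec, dotProduct, Fin.sum_univ_three] at e0 e1
  simp only [Matrix.of_apply, Matrix.cons_val', Matrix.cons_val_zero, Matrix.cons_val_one,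
    Matrix.cons_val, Pi.zero_apply] at e0 e1
  have hq : IsQuadraticTheta τ (fun u => f u * v 0 + g u * v 1 + h u * v 2) := by
    have := hf.differentiable
    have := hg.differentiable
    have := hh.differentiable
    refine ⟨by fun_prop, fun u => ?_, fun u => ?_⟩
    · simp only [hf.add_one, hg.add_one, hh.add_one]
    · simp only [hf.add_tau, hg.add_tau, hh.add_tau]
      ring
  refine ⟨v 0, v 1, v 2, fun hz => hv ?_, fun u => hq.eq_zero ?_ ?_ u⟩
  · ext i
    fin_cases i
    exacts [hz.1, hz.2.1, hz.2.2]
  · rw [fourierInt_linear hf hg hh, e0]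
  · rw [fourierInt_linear hf hg hh, e1]

end IsQuadraticTheta

/-! ### Nontriviality of θ₁ and its zeros on the lattice -/

/-- If θ were zero, integrating the series for exp(-πi x) θ(x) over [0, 1] would leave only the n =
0 term, a nonzero exponential. -/
lemma exists_thetaDeriv_ne_zero {τ : ℂ} (hτ : 0 < τ.im) : ∃ u, thetaDeriv 0 u τ ≠ 0 := by
  by_contra! h0
  have hc : ∀ n : ℤ, Continuous (fun x : ℝ => cexp (-(Real.pi * I * x)) * thetaTerm 0 n x τ) := by
    intro n
    unfold thetaTerm
    fun_prop
  have hs := intervalIntegral.hasSum_integral_of_dominated_convergence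
    (μ := MeasureTheory.volume) (a := 0) (b := 1)
    (F := fun (n : ℤ) (x : ℝ) => cexp (-(Real.pi * I * x)) * thetaTerm 0 n x τ)
    (f := fun _ => 0) (fun n _ => thetaBound 0 0 τ.im n)
    (fun n => (hc n).aestronglyMeasurable)
    (fun n => Filter.Eventually.of_forall fun x _ => by
      have e : ‖cexp (-(Real.pi * I * x))‖ = 1 := by
        rw [show -(Real.pi * I * x) = ((-(Real.pi * x) : ℝ) : ℂ) * I by push_cast; ring]
        exact norm_exp_ofReal_mul_I _
      rw [norm_mul, e, one_mul]
      exact norm_thetaTerm_le 0 n hτ (by simp) le_rfl)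
    (Filter.Eventually.of_forall fun x _ => summable_thetaBound 0 0 hτ)
    (by simp)
    (Filter.Eventually.of_forall fun x _ => by
      have := (hasSum_thetaTerm 0 x hτ).mul_left (cexp (-(Real.pi * I * x)))
      rwa [h0, neg_zero, mul_zero] at this)
  have hterm : ∀ (n : ℤ) (x : ℝ), cexp (-(Real.pi * I * x)) * thetaTerm 0 n x τ =
      cexp (Real.pi * I * τ * ((n : ℂ) + 1 / 2) ^ 2 + Real.pi * I * ((n : ℂ) + 1 / 2)) *
        cexp ((2 * Real.pi * I * n) * x) := by
    intro n x
    rw [thetaTerm, pow_zero, one_mul, ← exp_add, ← exp_add]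
    congr 1
    ring
  have hz : ∀ n : ℤ, n ≠ 0 →
      ∫ x in (0 : ℝ)..1, cexp (-(Real.pi * I * x)) * thetaTerm 0 n x τ = 0 := by
    intro n hn
    have hne : 2 * Real.pi * I * (n : ℂ) ≠ 0 := by
      simp [Real.pi_ne_zero, hn]
    simp only [hterm]
    rw [intervalIntegral.integral_const_mul, integral_exp_mul_complex hne,
      show 2 * Real.pi * I * (n : ℂ) * ((1 : ℝ) : ℂ) = n * (2 * Real.pi * I) by push_cast; ring,
      exp_int_mul_two_pi_mul_I]
    simp
  have h1 := hs.unique (hasSum_single 0 hz)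
  simp only [hterm] at h1
  simp only [Int.cast_zero, mul_zero, zero_mul, exp_zero, mul_one,
    intervalIntegral.integral_const, smul_zero, sub_zero, one_smul] at h1
  exact exp_ne_zero _ h1.symm

lemma mem_lattice_periods {τ : ℂ} (hτ : 0 < τ.im) {u : ℂ} :
    u ∈ (periods τ hτ).lattice ↔ ∃ m n : ℤ, (m : ℂ) + n * τ = u := by
  rw [PeriodPair.mem_lattice]
  simp [periods]

lemma one_mem_lattice {τ : ℂ} (hτ : 0 < τ.im) : (1 : ℂ) ∈ (periods τ hτ).lattice :=
  (periods τ hτ).ω₁_mem_lattice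

lemma tau_mem_lattice {τ : ℂ} (hτ : 0 < τ.im) : τ ∈ (periods τ hτ).lattice :=
  (periods τ hτ).ω₂_mem_lattice

lemma thetaDeriv_one_add_tau (u : ℂ) {τ : ℂ} (hτ : 0 < τ.im) : thetaDeriv 1 (u + τ) τ =
    -cexp (-(Real.pi * I * τ) - 2 * Real.pi * I * u) *
      (thetaDeriv 1 u τ - 2 * Real.pi * I * thetaDeriv 0 u τ) := by
  have h1 : HasDerivAt (fun w => thetaDeriv 0 (w + τ) τ) (thetaDeriv 1 (u + τ) τ) u := by
    simpa using (hasDerivAt_thetaDeriv_fst 0 (u + τ) hτ).comp_add_const u τ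
  have h2 := (((((hasDerivAt_id u).const_mul (2 * Real.pi * I)).const_sub
    (-(Real.pi * I * τ))).cexp).neg).mul (hasDerivAt_thetaDeriv_fst 0 u hτ)
  have h3 := h1.unique (h2.congr_of_eventuallyEq
    (Eventually.of_forall fun w => thetaDeriv_zero_add_tau w τ))
  rw [h3]
  simp only [id, zero_add, Pi.neg_apply]
  ring

lemma thetaDeriv_zero_of_mem_lattice {τ : ℂ} (hτ : 0 < τ.im) {u : ℂ}
    (hu : u ∈ (periods τ hτ).lattice) : thetaDeriv 0 u τ = 0 := by
  obtain ⟨m, n, rfl⟩ := (mem_lattice_periods hτ).mp hu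
  clear hu
  have ht : ∀ u, thetaDeriv 0 (u + τ) τ = 0 ↔ thetaDeriv 0 u τ = 0 := fun u => by
    rw [thetaDeriv_zero_add_tau, mul_eq_zero, neg_eq_zero]
    simp [exp_ne_zero]
  have hn : thetaDeriv 0 (n * τ) τ = 0 := by
    induction n using Int.induction_on with
    | zero => simpa using thetaDeriv_even_zero (k := 0) (by simp) τ
    | succ n ih =>
      rw [← ht] at ih
      convert ih using 2
      push_cast; ring
    | pred n ih =>
      rw [← ht]
      convert ih using 2
      push_cast; ring
  induction m using Int.induction_on with
  | zero => simpa using hn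
  | succ m ih =>
    rw [← neg_eq_zero, ← thetaDeriv_add_one] at ih
    convert ih using 2
    push_cast; ring
  | pred m ih =>
    rw [← neg_eq_zero, ← thetaDeriv_add_one]
    convert ih using 2
    push_cast; ring

/-! ### The entire function θ₁²℘ -/

open Classical in
/-- The entire function that agrees with `θ₁² ℘` away from the lattice. -/
noncomputable def thetaSqWeierstrass (τ : ℂ) (hτ : 0 < τ.im) (u : ℂ) : ℂ :=
  if u ∈ (periods τ hτ).lattice then thetaDeriv 1 u τ ^ 2
  else thetaDeriv 0 u τ ^ 2 * (periods τ hτ).weierstrassP u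

lemma thetaSqWeierstrass_of_notMem {τ : ℂ} (hτ : 0 < τ.im) {u : ℂ}
    (hu : u ∉ (periods τ hτ).lattice) : thetaSqWeierstrass τ hτ u =
      thetaDeriv 0 u τ ^ 2 * (periods τ hτ).weierstrassP u := if_neg hu

lemma thetaSqWeierstrass_zero {τ : ℂ} (hτ : 0 < τ.im) :
    thetaSqWeierstrass τ hτ 0 = thetaDeriv 1 0 τ ^ 2 := if_pos (zero_mem _)

lemma differentiable_thetaDeriv (k : ℕ) {τ : ℂ} (hτ : 0 < τ.im) :
    Differentiable ℂ (fun u => thetaDeriv k u τ) :=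
  fun u => (hasDerivAt_thetaDeriv_fst k u hτ).differentiableAt

lemma analyticOnNhd_univ {f : ℂ → ℂ} (hf : Differentiable ℂ f) : AnalyticOnNhd ℂ f Set.univ :=
  hf.differentiableOn.analyticOnNhd isOpen_univ

lemma differentiable_thetaSqWeierstrass {τ : ℂ} (hτ : 0 < τ.im) :
    Differentiable ℂ (thetaSqWeierstrass τ hτ) := by
  intro l
  have hθ := differentiable_thetaDeriv 0 hτ
  by_cases hl : l ∈ (periods τ hτ).lattice
  · have hds : DifferentiableAt ℂ (dslope (fun u => thetaDeriv 0 u τ) l) l :=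
      ((differentiableOn_dslope univ_mem).mpr hθ.differentiableOn).differentiableAt univ_mem
    have hP : DifferentiableAt ℂ ((periods τ hτ).weierstrassPExcept l) l :=
      ((periods τ hτ).analyticAt_weierstrassPExcept l).differentiableAt
    -- The function is locally (θ(u)/(u - l))² · (u - l)²℘(u). At l = 0 the convention 1/0 = 0
    -- removes the last summand, as it should: the term 1/u² of ℘ carries no correction.
    have hd : DifferentiableAt ℂ (fun u => dslope (fun u => thetaDeriv 0 u τ) l u ^ 2 *
        ((u - l) ^ 2 * (periods τ hτ).weierstrassPExcept l u + 1 - (u - l) ^ 2 / l ^ 2)) l := by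
      refine (hds.pow 2).mul ?_
      fun_prop
    refine hd.congr_of_eventuallyEq ?_
    filter_upwards [(periods τ hτ).compl_lattice_sdiff_singleton_mem_nhds l] with u hu
    rw [← (periods τ hτ).ite_eq_one_sub_sq_mul_weierstrassP l hl]
    by_cases hul : u = l
    · subst hul
      rw [if_pos rfl, mul_one, dslope_same, (hasDerivAt_thetaDeriv_fst 0 u hτ).deriv]
      exact if_pos hl
    · have huL : u ∉ (periods τ hτ).lattice := fun h => hu ⟨h, hul⟩
      rw [if_neg hul, thetaSqWeierstrass_of_notMem hτ huL, dslope_of_ne _ hul, slope_def_field,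
        thetaDeriv_zero_of_mem_lattice hτ hl, sub_zero]
      have := sub_ne_zero.mpr hul
      field_simp
  · have hP : DifferentiableAt ℂ (periods τ hτ).weierstrassP l :=
      ((periods τ hτ).analyticOnNhd_weierstrassP l hl).differentiableAt
    refine (((hθ l).pow 2).mul hP).congr_of_eventuallyEq ?_
    filter_upwards [(periods τ hτ).isClosed_lattice.isOpen_compl.mem_nhds hl] with u hu
    exact thetaSqWeierstrass_of_notMem hτ hu

lemma isQuadraticTheta_theta_mul (a : ℂ) {τ : ℂ} (hτ : 0 < τ.im) :
    IsQuadraticTheta τ (fun u => thetaDeriv 0 (u + a) τ * thetaDeriv 0 (u - a) τ) := by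
  have hθ := differentiable_thetaDeriv 0 hτ
  refine ⟨(hθ.comp (differentiable_id.add_const a)).mul (hθ.comp (differentiable_id.sub_const a)),
    fun u => ?_, fun u => ?_⟩
  · rw [add_right_comm, add_sub_right_comm, thetaDeriv_add_one, thetaDeriv_add_one, neg_mul_neg]
  · rw [add_right_comm, add_sub_right_comm, thetaDeriv_zero_add_tau, thetaDeriv_zero_add_tau,
      show -(2 * Real.pi * I * τ) - 4 * Real.pi * I * u =
        (-(Real.pi * I * τ) - 2 * Real.pi * I * (u + a)) +
        (-(Real.pi * I * τ) - 2 * Real.pi * I * (u - a)) by ring, exp_add]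
    ring

lemma isQuadraticTheta_theta_sq {τ : ℂ} (hτ : 0 < τ.im) :
    IsQuadraticTheta τ (fun u => thetaDeriv 0 u τ ^ 2) := by
  simpa [sq] using isQuadraticTheta_theta_mul 0 hτ

lemma isQuadraticTheta_thetaSqWeierstrass {τ : ℂ} (hτ : 0 < τ.im) :
    IsQuadraticTheta τ (thetaSqWeierstrass τ hτ) := by
  have hsq : ∀ u, cexp (-(2 * Real.pi * I * τ) - 4 * Real.pi * I * u) =
      cexp (-(Real.pi * I * τ) - 2 * Real.pi * I * u) ^ 2 := fun u => by
    rw [sq, ← exp_add]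
    congr 1
    ring
  refine ⟨differentiable_thetaSqWeierstrass hτ, fun u => ?_, fun u => ?_⟩
  · by_cases hu : u ∈ (periods τ hτ).lattice
    · rw [thetaSqWeierstrass, thetaSqWeierstrass, if_pos hu,
        if_pos (add_mem hu (one_mem_lattice hτ)), thetaDeriv_add_one, neg_sq]
    · rw [thetaSqWeierstrass_of_notMem hτ hu, thetaSqWeierstrass_of_notMem hτ
        (fun h => hu ((add_mem_cancel_right (one_mem_lattice hτ)).mp h)), thetaDeriv_add_one, neg_sq]
      congr 1
      exact (periods τ hτ).weierstrassP_add_coe u ⟨1, one_mem_lattice hτ⟩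
  · by_cases hu : u ∈ (periods τ hτ).lattice
    · rw [thetaSqWeierstrass, thetaSqWeierstrass, if_pos hu,
        if_pos (add_mem hu (tau_mem_lattice hτ)), thetaDeriv_one_add_tau u hτ,
        thetaDeriv_zero_of_mem_lattice hτ hu, hsq]
      ring
    · rw [thetaSqWeierstrass_of_notMem hτ hu, thetaSqWeierstrass_of_notMem hτ
        (fun h => hu ((add_mem_cancel_right (tau_mem_lattice hτ)).mp h)), thetaDeriv_zero_add_tau,
        hsq, show (periods τ hτ).weierstrassP (u + τ) = (periods τ hτ).weierstrassP u from
          (periods τ hτ).weierstrassP_add_coe u ⟨τ, tau_mem_lattice hτ⟩]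
      ring

lemma eventually_thetaDeriv_ne_zero {τ : ℂ} (hτ : 0 < τ.im) (a : ℂ) :
    ∀ᶠ u in 𝓝[≠] a, thetaDeriv 0 u τ ≠ 0 := by
  have hA := analyticOnNhd_univ (differentiable_thetaDeriv 0 hτ)
  refine ((hA a trivial).eventually_eq_zero_or_eventually_ne_zero).resolve_left fun h => ?_
  obtain ⟨u, hu⟩ := exists_thetaDeriv_ne_zero hτ
  exact hu (hA.eqOn_zero_of_preconnected_of_eventuallyEq_zero isPreconnected_univ trivial h
    (Set.mem_univ u))

/-- Otherwise ℘ would equal c on a punctured neighbourhood of 0, where it has a pole. -/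
lemma not_thetaSqWeierstrass_eq_mul {τ : ℂ} (hτ : 0 < τ.im) (c : ℂ) :
    ¬∀ u, thetaSqWeierstrass τ hτ u = c * thetaDeriv 0 u τ ^ 2 := by
  intro h
  have ht : Tendsto (periods τ hτ).weierstrassP (𝓝[≠] 0) (Bornology.cobounded ℂ) :=
    tendsto_cobounded_of_meromorphicOrderAt_neg (by
      rw [(periods τ hτ).order_weierstrassP 0 (zero_mem _)]
      exact compareOfLessAndEq_eq_lt.mp rfl)
  have hc : Tendsto (periods τ hτ).weierstrassP (𝓝[≠] 0) (𝓝 c) := by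
    refine tendsto_const_nhds.congr' ?_
    filter_upwards [eventually_thetaDeriv_ne_zero hτ 0, nhdsWithin_le_nhds
      ((periods τ hτ).compl_lattice_sdiff_singleton_mem_nhds 0), self_mem_nhdsWithin] with u h1 h2 h3
    have hu : u ∉ (periods τ hτ).lattice := fun h => h2 ⟨h, h3⟩
    have := h u
    rw [thetaSqWeierstrass_of_notMem hτ hu, mul_comm] at this
    exact (mul_right_cancel₀ (pow_ne_zero 2 h1) this).symm
  exact not_tendsto_nhds_of_tendsto_atTop (tendsto_norm_cobounded_atTop.comp ht) _ hc.norm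

/-! ### The addition formula and the zeros of θ₁ -/

/-- The addition formula for `θ₁(u + a) θ₁(u - a)`, in pole-free form. -/
lemma theta_add_mul_theta_sub {τ : ℂ} (hτ : 0 < τ.im) (u a : ℂ) :
    thetaDeriv 1 0 τ ^ 2 * (thetaDeriv 0 (u + a) τ * thetaDeriv 0 (u - a) τ) =
      thetaSqWeierstrass τ hτ a * thetaDeriv 0 u τ ^ 2 -
        thetaDeriv 0 a τ ^ 2 * thetaSqWeierstrass τ hτ u := by
  have h00 : thetaDeriv 0 0 τ = 0 := thetaDeriv_even_zero (by simp) τ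
  have hθ := differentiable_thetaDeriv 0 hτ
  have hH := differentiable_thetaSqWeierstrass hτ
  have key : ∀ a, thetaDeriv 0 a τ ≠ 0 →
      thetaDeriv 1 0 τ ^ 2 * (thetaDeriv 0 (u + a) τ * thetaDeriv 0 (u - a) τ) =
      thetaSqWeierstrass τ hτ a * thetaDeriv 0 u τ ^ 2 -
        thetaDeriv 0 a τ ^ 2 * thetaSqWeierstrass τ hτ u := by
    intro a ha
    obtain ⟨α, β, γ, hne, h⟩ := (isQuadraticTheta_theta_sq hτ).exists_linear_relation
      (isQuadraticTheta_thetaSqWeierstrass hτ) (isQuadraticTheta_theta_mul a hτ)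
    have hγ : γ ≠ 0 := by
      rintro rfl
      have hβ : β = 0 := by
        by_contra hβ
        refine not_thetaSqWeierstrass_eq_mul hτ (-α / β) fun u => ?_
        field_simp
        linear_combination h u
      subst hβ
      have := h a
      simp only [mul_zero, add_zero, mul_eq_zero, pow_eq_zero_iff two_ne_zero, ha, false_or] at this
      exact hne ⟨this, rfl, rfl⟩
    have h0 := h 0
    have ha' := h a
    have hu := h u
    -- At u = 0 the relation reads β θ'(0)² = γ θ(a)²; at u = a the product term drops out.
    rw [thetaSqWeierstrass_zero, h00, zero_add, zero_sub, thetaDeriv_neg] at h0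
    rw [sub_self, h00] at ha'
    have hα : α * thetaDeriv 1 0 τ ^ 2 = -γ * thetaSqWeierstrass τ hτ a := by
      refine mul_left_cancel₀ (pow_ne_zero 2 ha) ?_
      linear_combination thetaDeriv 1 0 τ ^ 2 * ha' - thetaSqWeierstrass τ hτ a * h0
    refine mul_left_cancel₀ hγ ?_
    linear_combination thetaDeriv 1 0 τ ^ 2 * hu - thetaSqWeierstrass τ hτ u * h0 -
      thetaDeriv 0 u τ ^ 2 * hα
  have hE : AnalyticOnNhd ℂ (fun a =>
      thetaDeriv 1 0 τ ^ 2 * (thetaDeriv 0 (u + a) τ * thetaDeriv 0 (u - a) τ) -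
      (thetaSqWeierstrass τ hτ a * thetaDeriv 0 u τ ^ 2 -
        thetaDeriv 0 a τ ^ 2 * thetaSqWeierstrass τ hτ u)) Set.univ := by
    refine analyticOnNhd_univ ?_
    have h1 : Differentiable ℂ fun a => thetaDeriv 0 (u + a) τ :=
      hθ.comp (differentiable_id.const_add u)
    have h2 : Differentiable ℂ fun a => thetaDeriv 0 (u - a) τ :=
      hθ.comp (differentiable_id.const_sub u)
    fun_prop
  -- The zeros of θ are not yet known, so the case θ(a) = 0 comes from analyticity in a: the defect
  -- times θ vanishes identically and θ does not.
  rcases hE.eq_zero_or_eq_zero_of_mul_eq_zero (analyticOnNhd_univ hθ) (fun a _ => by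
    by_cases ha : thetaDeriv 0 a τ = 0
    · rw [ha, mul_zero]
    · rw [sub_eq_zero.mpr (key a ha), zero_mul]) isPreconnected_univ with h | h
  · exact sub_eq_zero.mp (h a trivial)
  · obtain ⟨b, hb⟩ := exists_thetaDeriv_ne_zero hτ
    exact absurd (h b trivial) hb

/-- If θ'(0) = 0, the addition formula makes θ²℘ a multiple of θ². -/
lemma thetaDeriv_one_zero_ne_zero {τ : ℂ} (hτ : 0 < τ.im) : thetaDeriv 1 0 τ ≠ 0 := by
  intro h
  obtain ⟨a, ha⟩ := exists_thetaDeriv_ne_zero hτ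
  refine not_thetaSqWeierstrass_eq_mul hτ (thetaSqWeierstrass τ hτ a / thetaDeriv 0 a τ ^ 2)
    fun u => ?_
  have := theta_add_mul_theta_sub hτ u a
  rw [h] at this
  field_simp
  linear_combination this

/-- A zero a off the lattice kills the right side of the addition formula, so θ(u+a)θ(u-a) would
vanish for all u. -/
lemma thetaDeriv_zero_ne_zero {τ : ℂ} (hτ : 0 < τ.im) {a : ℂ}
    (ha : a ∉ (periods τ hτ).lattice) : thetaDeriv 0 a τ ≠ 0 := by
  intro h
  have hθ := differentiable_thetaDeriv 0 hτ
  have h1 : AnalyticOnNhd ℂ (fun u => thetaDeriv 0 (u + a) τ) Set.univ :=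
    analyticOnNhd_univ (hθ.comp (differentiable_id.add_const a))
  have h2 : AnalyticOnNhd ℂ (fun u => thetaDeriv 0 (u - a) τ) Set.univ :=
    analyticOnNhd_univ (hθ.comp (differentiable_id.sub_const a))
  obtain ⟨b, hb⟩ := exists_thetaDeriv_ne_zero hτ
  rcases h1.eq_zero_or_eq_zero_of_mul_eq_zero h2 (fun u _ => by
    have := theta_add_mul_theta_sub hτ u a
    rw [thetaSqWeierstrass_of_notMem hτ ha, h] at this
    simpa [thetaDeriv_one_zero_ne_zero hτ] using this) isPreconnected_univ with h3 | h3
  · exact hb (by simpa using h3 (b - a) trivial)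
  · exact hb (by simpa using h3 (b + a) trivial)

/-! ### Weierstrass's relation and its degenerations -/

section ThetaIdentities

variable {τ : ℂ} (hτ : 0 < τ.im)

include hτ

lemma weierstrassP_sub_weierstrassP {u v : ℂ} (hu : u ∉ (periods τ hτ).lattice)
    (hv : v ∉ (periods τ hτ).lattice) :
    (periods τ hτ).weierstrassP u - (periods τ hτ).weierstrassP v =
      -(thetaDeriv 1 0 τ ^ 2 * (thetaDeriv 0 (u + v) τ * thetaDeriv 0 (u - v) τ)) /
        (thetaDeriv 0 u τ ^ 2 * thetaDeriv 0 v τ ^ 2) := by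
  have h := theta_add_mul_theta_sub hτ u v
  rw [thetaSqWeierstrass_of_notMem hτ hu, thetaSqWeierstrass_of_notMem hτ hv] at h
  have := thetaDeriv_zero_ne_zero hτ hu
  have := thetaDeriv_zero_ne_zero hτ hv
  field_simp
  linear_combination h

/-- The three-term relation of Weierstrass. -/
lemma theta_three_term (x y z w : ℂ) :
    thetaDeriv 0 (x + y) τ * thetaDeriv 0 (x - y) τ *
        (thetaDeriv 0 (z + w) τ * thetaDeriv 0 (z - w) τ) -
      thetaDeriv 0 (x + z) τ * thetaDeriv 0 (x - z) τ *
        (thetaDeriv 0 (y + w) τ * thetaDeriv 0 (y - w) τ) +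
      thetaDeriv 0 (y + z) τ * thetaDeriv 0 (y - z) τ *
        (thetaDeriv 0 (x + w) τ * thetaDeriv 0 (x - w) τ) = 0 := by
  have hF := theta_add_mul_theta_sub hτ
  refine mul_left_cancel₀ (pow_ne_zero 4 (thetaDeriv_one_zero_ne_zero hτ)) ?_
  set c := thetaDeriv 1 0 τ
  set F : ℂ → ℂ → ℂ := fun x y => thetaDeriv 0 (x + y) τ * thetaDeriv 0 (x - y) τ
  -- Each c²F is a 2×2 minor in the values of θ²℘ and θ², so this is the Plücker relation.
  calc c ^ 4 * (F x y * F z w - F x z * F y w + F y z * F x w)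
      = (c ^ 2 * F x y) * (c ^ 2 * F z w) - (c ^ 2 * F x z) * (c ^ 2 * F y w) +
        (c ^ 2 * F y z) * (c ^ 2 * F x w) := by ring
    _ = c ^ 4 * 0 := by
      simp only [F, c, hF]
      ring

lemma hasDerivAt_thetaDeriv_const_add (k : ℕ) (a w : ℂ) :
    HasDerivAt (fun w => thetaDeriv k (a + w) τ) (thetaDeriv (k + 1) (a + w) τ) w :=
  (hasDerivAt_thetaDeriv_fst k (a + w) hτ).comp_const_add a w

lemma hasDerivAt_thetaDeriv_sub_const (k : ℕ) (a w : ℂ) :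
    HasDerivAt (fun w => thetaDeriv k (w - a) τ) (thetaDeriv (k + 1) (w - a) τ) w :=
  (hasDerivAt_thetaDeriv_fst k (w - a) hτ).comp_sub_const w a

lemma hasDerivAt_thetaDeriv_const_sub (k : ℕ) (a w : ℂ) :
    HasDerivAt (fun w => thetaDeriv k (a - w) τ) (-thetaDeriv (k + 1) (a - w) τ) w :=
  (hasDerivAt_thetaDeriv_fst k (a - w) hτ).comp_const_sub a w

/-- The w-derivative of the three-term relation at (u - z/2, v - z/2, z/2, w), taken at w = z/2;
there θ(z/2 - w) vanishes, so only its derivative contributes to the first product. -/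
lemma theta_log_deriv_relation (u v z : ℂ) :
    thetaDeriv 1 0 τ * thetaDeriv 0 z τ * (thetaDeriv 0 (u - z + v) τ * thetaDeriv 0 (u - v) τ) =
      (thetaDeriv 1 u τ * thetaDeriv 0 (u - z) τ - thetaDeriv 0 u τ * thetaDeriv 1 (u - z) τ) *
        (thetaDeriv 0 v τ * thetaDeriv 0 (v - z) τ) -
      thetaDeriv 0 u τ * thetaDeriv 0 (u - z) τ *
        (thetaDeriv 1 v τ * thetaDeriv 0 (v - z) τ - thetaDeriv 0 v τ * thetaDeriv 1 (v - z) τ) := by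
  have hF : ∀ a, HasDerivAt (fun w => thetaDeriv 0 (a + w) τ * thetaDeriv 0 (a - w) τ)
      (thetaDeriv 1 (a + z / 2) τ * thetaDeriv 0 (a - z / 2) τ -
        thetaDeriv 0 (a + z / 2) τ * thetaDeriv 1 (a - z / 2) τ) (z / 2) := fun a => by
    refine ((hasDerivAt_thetaDeriv_const_add hτ 0 a (z / 2)).mul
      (hasDerivAt_thetaDeriv_const_sub hτ 0 a (z / 2))).congr_deriv ?_
    ring
  set x := u - z / 2 with hx
  set y := v - z / 2 with hy
  have h1 := (((hF (z / 2)).const_mul (thetaDeriv 0 (x + y) τ * thetaDeriv 0 (x - y) τ)).sub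
    ((hF y).const_mul (thetaDeriv 0 (x + z / 2) τ * thetaDeriv 0 (x - z / 2) τ))).add
    ((hF x).const_mul (thetaDeriv 0 (y + z / 2) τ * thetaDeriv 0 (y - z / 2) τ))
  have h2 := h1.unique ((hasDerivAt_const (z / 2) (0 : ℂ)).congr_of_eventuallyEq
    (Eventually.of_forall fun w => theta_three_term hτ x y (z / 2) w))
  rw [show x + y = u - z + v by rw [hx, hy]; ring, show x - y = u - v by rw [hx, hy]; ring,
    show x + z / 2 = u by rw [hx]; ring, show x - z / 2 = u - z by rw [hx]; ring,
    show y + z / 2 = v by rw [hy]; ring, show y - z / 2 = v - z by rw [hy]; ring,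
    add_halves, sub_self, thetaDeriv_even_zero (k := 0) (by simp)] at h2
  linear_combination -h2

/-- The second-order degeneration of `theta_log_deriv_relation` as `v → 0`. -/
lemma theta_second_order_relation (u z : ℂ) :
    thetaDeriv 1 0 τ * thetaDeriv 0 z τ *
        (thetaDeriv 2 (u - z) τ * thetaDeriv 0 u τ - 2 * thetaDeriv 1 (u - z) τ * thetaDeriv 1 u τ +
          thetaDeriv 0 (u - z) τ * thetaDeriv 2 u τ) =
      2 * thetaDeriv 1 0 τ * thetaDeriv 1 z τ *
        (thetaDeriv 1 u τ * thetaDeriv 0 (u - z) τ - thetaDeriv 0 u τ * thetaDeriv 1 (u - z) τ) +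
      thetaDeriv 0 u τ * thetaDeriv 0 (u - z) τ *
        (thetaDeriv 3 0 τ * thetaDeriv 0 z τ - thetaDeriv 1 0 τ * thetaDeriv 2 z τ) := by
  have p (k : ℕ) (v : ℂ) := hasDerivAt_thetaDeriv_const_add hτ k (u - z) v
  have q (k : ℕ) (v : ℂ) := hasDerivAt_thetaDeriv_const_sub hτ k u v
  have r (k : ℕ) (v : ℂ) := hasDerivAt_thetaDeriv_fst k v hτ
  have s (k : ℕ) (v : ℂ) := hasDerivAt_thetaDeriv_sub_const hτ k z v
  -- At v = 0 the relation and its first derivative are trivial; the first derivative is therefore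
  -- kept for all v and differentiated once more.
  have first : ∀ v, thetaDeriv 1 0 τ * thetaDeriv 0 z τ *
      (thetaDeriv 1 (u - z + v) τ * thetaDeriv 0 (u - v) τ -
        thetaDeriv 0 (u - z + v) τ * thetaDeriv 1 (u - v) τ) =
      (thetaDeriv 1 u τ * thetaDeriv 0 (u - z) τ - thetaDeriv 0 u τ * thetaDeriv 1 (u - z) τ) *
        (thetaDeriv 1 v τ * thetaDeriv 0 (v - z) τ + thetaDeriv 0 v τ * thetaDeriv 1 (v - z) τ) -
      thetaDeriv 0 u τ * thetaDeriv 0 (u - z) τ *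
        (thetaDeriv 2 v τ * thetaDeriv 0 (v - z) τ - thetaDeriv 0 v τ * thetaDeriv 2 (v - z) τ) := by
    intro v
    have hl := ((p 0 v).mul (q 0 v)).const_mul (thetaDeriv 1 0 τ * thetaDeriv 0 z τ)
    have hr := (((r 0 v).mul (s 0 v)).const_mul
      (thetaDeriv 1 u τ * thetaDeriv 0 (u - z) τ - thetaDeriv 0 u τ * thetaDeriv 1 (u - z) τ)).sub
      ((((r 1 v).mul (s 0 v)).sub ((r 0 v).mul (s 1 v))).const_mul
        (thetaDeriv 0 u τ * thetaDeriv 0 (u - z) τ))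
    have h := hl.unique (hr.congr_of_eventuallyEq
      (Eventually.of_forall fun v => theta_log_deriv_relation hτ u v z))
    linear_combination h
  have hl := (((p 1 0).mul (q 0 0)).sub ((p 0 0).mul (q 1 0))).const_mul
    (thetaDeriv 1 0 τ * thetaDeriv 0 z τ)
  have hr := ((((r 1 0).mul (s 0 0)).add ((r 0 0).mul (s 1 0))).const_mul
      (thetaDeriv 1 u τ * thetaDeriv 0 (u - z) τ - thetaDeriv 0 u τ * thetaDeriv 1 (u - z) τ)).sub
      ((((r 2 0).mul (s 0 0)).sub ((r 0 0).mul (s 2 0))).const_mul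
        (thetaDeriv 0 u τ * thetaDeriv 0 (u - z) τ))
  have h := hl.unique (hr.congr_of_eventuallyEq (Eventually.of_forall first))
  simp only [add_zero, sub_zero, zero_sub, zero_add, Nat.reduceAdd, thetaDeriv_neg,
    thetaDeriv_even_zero (k := 0) (by simp) τ, thetaDeriv_even_zero (k := 2) (by simp) τ] at h
  linear_combination h

end ThetaIdentities

/-! ### The kernel x and the four identities -/

section Kernel

variable {τ : ℂ} (hτ : 0 < τ.im)

include hτ

lemma x_eq (u z : ℂ) : x u z τ =
    thetaDeriv 0 (z - u) τ * thetaDeriv 1 0 τ / (thetaDeriv 0 z τ * thetaDeriv 0 u τ) := by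
  simp only [x, theta₁_eq_thetaDeriv, (hasDerivAt_thetaDeriv_fst 0 0 hτ).deriv]

lemma hasDerivAt_x_fst {u : ℂ} (z : ℂ) (hu : u ∉ (periods τ hτ).lattice) :
    HasDerivAt (fun w => x w z τ) (thetaDeriv 1 0 τ / thetaDeriv 0 z τ *
      ((-thetaDeriv 1 (z - u) τ * thetaDeriv 0 u τ - thetaDeriv 0 (z - u) τ * thetaDeriv 1 u τ) /
        thetaDeriv 0 u τ ^ 2)) u := by
  refine (((hasDerivAt_thetaDeriv_const_sub hτ 0 z u).div (hasDerivAt_thetaDeriv_fst 0 u hτ)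
    (thetaDeriv_zero_ne_zero hτ hu)).const_mul
      (thetaDeriv 1 0 τ / thetaDeriv 0 z τ)).congr_of_eventuallyEq
    (Eventually.of_forall fun w => ?_)
  simp only [x_eq hτ, Pi.div_apply, div_mul_div_comm, mul_comm]

lemma hasDerivAt_x_snd (u : ℂ) {z : ℂ} (hz : z ∉ (periods τ hτ).lattice) :
    HasDerivAt (fun ζ => x u ζ τ) (thetaDeriv 1 0 τ / thetaDeriv 0 u τ *
      ((thetaDeriv 1 (z - u) τ * thetaDeriv 0 z τ - thetaDeriv 0 (z - u) τ * thetaDeriv 1 z τ) /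
        thetaDeriv 0 z τ ^ 2)) z := by
  refine (((hasDerivAt_thetaDeriv_sub_const hτ 0 u z).div (hasDerivAt_thetaDeriv_fst 0 z hτ)
    (thetaDeriv_zero_ne_zero hτ hz)).const_mul
      (thetaDeriv 1 0 τ / thetaDeriv 0 u τ)).congr_of_eventuallyEq
    (Eventually.of_forall fun w => ?_)
  simp only [x_eq hτ, Pi.div_apply, div_mul_div_comm, mul_comm]

lemma hasDerivAt_deriv_x {u z : ℂ} (hu : u ∉ (periods τ hτ).lattice)
    (hz : z ∉ (periods τ hτ).lattice) :
    HasDerivAt (fun w => deriv (fun ζ => x w ζ τ) z) (thetaDeriv 1 0 τ / thetaDeriv 0 z τ ^ 2 *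
      (((-thetaDeriv 2 (z - u) τ * thetaDeriv 0 z τ + thetaDeriv 1 (z - u) τ * thetaDeriv 1 z τ) *
          thetaDeriv 0 u τ -
        (thetaDeriv 1 (z - u) τ * thetaDeriv 0 z τ - thetaDeriv 0 (z - u) τ * thetaDeriv 1 z τ) *
          thetaDeriv 1 u τ) / thetaDeriv 0 u τ ^ 2)) u := by
  have h := ((((hasDerivAt_thetaDeriv_const_sub hτ 1 z u).mul_const (thetaDeriv 0 z τ)).sub
    ((hasDerivAt_thetaDeriv_const_sub hτ 0 z u).mul_const (thetaDeriv 1 z τ))).div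
    (hasDerivAt_thetaDeriv_fst 0 u hτ) (thetaDeriv_zero_ne_zero hτ hu)).const_mul
      (thetaDeriv 1 0 τ / thetaDeriv 0 z τ ^ 2)
  refine (h.congr_of_eventuallyEq (Eventually.of_forall fun w => ?_)).congr_deriv ?_
  -- The z-derivative formula holds for every w, even on the lattice, where division by θ(w) = 0
  -- gives zero on both sides.
  · simp only [(hasDerivAt_x_snd hτ w hz).deriv, Pi.div_apply, Pi.sub_apply, div_mul_div_comm,
      mul_comm]
  · simp only [Pi.sub_apply, zero_add, Nat.reduceAdd]
    ring

lemma hasDerivAt_x_tau {u z : ℂ} (hu : u ∉ (periods τ hτ).lattice)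
    (hz : z ∉ (periods τ hτ).lattice) :
    HasDerivAt (fun t => x u z t)
      (((thetaDeriv 2 (z - u) τ * thetaDeriv 1 0 τ + thetaDeriv 0 (z - u) τ * thetaDeriv 3 0 τ) *
          (thetaDeriv 0 z τ * thetaDeriv 0 u τ) -
        thetaDeriv 0 (z - u) τ * thetaDeriv 1 0 τ *
          (thetaDeriv 2 z τ * thetaDeriv 0 u τ + thetaDeriv 0 z τ * thetaDeriv 2 u τ)) /
        (thetaDeriv 0 z τ * thetaDeriv 0 u τ) ^ 2 / (4 * Real.pi * I)) τ := by
  have h := ((hasDerivAt_thetaDeriv_snd 0 (z - u) hτ).mul (hasDerivAt_thetaDeriv_snd 1 0 hτ)).div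
    ((hasDerivAt_thetaDeriv_snd 0 z hτ).mul (hasDerivAt_thetaDeriv_snd 0 u hτ))
    (mul_ne_zero (thetaDeriv_zero_ne_zero hτ hz) (thetaDeriv_zero_ne_zero hτ hu))
  refine (h.congr_of_eventuallyEq ?_).congr_deriv ?_
  · filter_upwards [(isOpen_lt continuous_const continuous_im).mem_nhds hτ] with t ht
    exact x_eq ht u z
  · simp only [Pi.mul_apply, zero_add, Nat.reduceAdd]
    ring

lemma x_mul_y_sub_y_mul_x {u v z : ℂ} (hu : u ∉ (periods τ hτ).lattice)
    (hv : v ∉ (periods τ hτ).lattice) (huv : u + v ∉ (periods τ hτ).lattice)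
    (hz : z ∉ (periods τ hτ).lattice) :
    x u z τ * y v z τ - y u z τ * x v z τ =
      x (u + v) z τ * ((periods τ hτ).weierstrassP u - (periods τ hτ).weierstrassP v) := by
  have hu0 := thetaDeriv_zero_ne_zero hτ hu
  have hv0 := thetaDeriv_zero_ne_zero hτ hv
  have huv0 := thetaDeriv_zero_ne_zero hτ huv
  have hz0 := thetaDeriv_zero_ne_zero hτ hz
  have h := theta_log_deriv_relation hτ u v z
  rw [weierstrassP_sub_weierstrassP hτ hu hv, y, y, (hasDerivAt_x_fst hτ z hu).deriv,
    (hasDerivAt_x_fst hτ z hv).deriv, x_eq hτ, x_eq hτ, x_eq hτ,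
    show z - u = -(u - z) by ring, show z - v = -(v - z) by ring,
    show z - (u + v) = -(u - z + v) by ring]
  simp only [thetaDeriv_neg]
  field_simp
  linear_combination thetaDeriv 1 0 τ ^ 2 * h

lemma neg_notMem_lattice {u : ℂ} (hu : u ∉ (periods τ hτ).lattice) :
    -u ∉ (periods τ hτ).lattice := fun h => hu (neg_mem_iff.mp h)

lemma x_mul_x_neg {u z : ℂ} (hu : u ∉ (periods τ hτ).lattice)
    (hz : z ∉ (periods τ hτ).lattice) :
    x u z τ * x (-u) z τ = (periods τ hτ).weierstrassP z - (periods τ hτ).weierstrassP u := by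
  have hu0 := thetaDeriv_zero_ne_zero hτ hu
  have hz0 := thetaDeriv_zero_ne_zero hτ hz
  rw [weierstrassP_sub_weierstrassP hτ hz hu, x_eq hτ, x_eq hτ, sub_neg_eq_add, thetaDeriv_neg]
  field_simp
  ring

/-- Differentiating x(u,z) x(-u,z) = ℘(z) - ℘(u) in u gives this up to sign. -/
lemma x_mul_y_neg_sub_y_mul_x_neg {u z : ℂ} (hu : u ∉ (periods τ hτ).lattice)
    (hz : z ∉ (periods τ hτ).lattice) :
    x u z τ * y (-u) z τ - y u z τ * x (-u) z τ = deriv (periods τ hτ).weierstrassP u := by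
  have hy : ∀ {w}, w ∉ (periods τ hτ).lattice → HasDerivAt (fun w => x w z τ) (y w z τ) w :=
    fun hw => (hasDerivAt_x_fst hτ z hw).differentiableAt.hasDerivAt
  have hn : HasDerivAt (fun w => x (-w) z τ) (-y (-u) z τ) u :=
    ((hy (neg_notMem_lattice hτ hu)).comp u (hasDerivAt_neg u)).congr_deriv (by ring)
  have hP := ((periods τ hτ).analyticOnNhd_weierstrassP u hu).differentiableAt.hasDerivAt
  have h := ((hy hu).mul hn).unique ((hP.const_sub _).congr_of_eventuallyEq (by
    filter_upwards [(periods τ hτ).isClosed_lattice.isOpen_compl.mem_nhds hu] with w hw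
    exact x_mul_x_neg hτ hw hz))
  linear_combination -h

lemma heat_equation {u z : ℂ} (hu : u ∉ (periods τ hτ).lattice)
    (hz : z ∉ (periods τ hτ).lattice) :
    2 * Real.pi * I * deriv (fun t => x u z t) τ
      + deriv (fun w => deriv (fun ζ => x w ζ τ) z) u = 0 := by
  have hu0 := thetaDeriv_zero_ne_zero hτ hu
  have hz0 := thetaDeriv_zero_ne_zero hτ hz
  have hpi : (Real.pi : ℂ) ≠ 0 := ofReal_ne_zero.mpr Real.pi_ne_zero
  have hI := I_ne_zero
  have h := theta_second_order_relation hτ u z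
  rw [(hasDerivAt_x_tau hτ hu hz).deriv, (hasDerivAt_deriv_x hτ hu hz).deriv,
    show z - u = -(u - z) by ring]
  simp only [thetaDeriv_neg]
  field_simp
  linear_combination 2 * h

end Kernel

end CalogeroKernel

theorem mainTheorem1 (τ : ℂ) (hτ : 0 < τ.im) :
    -- the three functional equations
    (∀ u v z : ℂ, u ∉ (CalogeroKernel.periods τ hτ).lattice →
      v ∉ (CalogeroKernel.periods τ hτ).lattice →
      u + v ∉ (CalogeroKernel.periods τ hτ).lattice →
      z ∉ (CalogeroKernel.periods τ hτ).lattice →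
      CalogeroKernel.x u z τ * CalogeroKernel.y v z τ
          - CalogeroKernel.y u z τ * CalogeroKernel.x v z τ
        = CalogeroKernel.x (u + v) z τ
          * ((CalogeroKernel.periods τ hτ).weierstrassP u
              - (CalogeroKernel.periods τ hτ).weierstrassP v)) ∧
    (∀ u z : ℂ, u ∉ (CalogeroKernel.periods τ hτ).lattice →
      z ∉ (CalogeroKernel.periods τ hτ).lattice →
      CalogeroKernel.x u z τ * CalogeroKernel.y (-u) z τ
          - CalogeroKernel.y u z τ * CalogeroKernel.x (-u) z τ
        = deriv (CalogeroKernel.periods τ hτ).weierstrassP u) ∧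
    (∀ u z : ℂ, u ∉ (CalogeroKernel.periods τ hτ).lattice →
      z ∉ (CalogeroKernel.periods τ hτ).lattice →
      CalogeroKernel.x u z τ * CalogeroKernel.x (-u) z τ
        = (CalogeroKernel.periods τ hτ).weierstrassP z
          - (CalogeroKernel.periods τ hτ).weierstrassP u) ∧
    -- every derivative that is used exists, and the heat equation holds
    (∀ u z : ℂ, u ∉ (CalogeroKernel.periods τ hτ).lattice →
      z ∉ (CalogeroKernel.periods τ hτ).lattice →
      DifferentiableAt ℂ (fun w => CalogeroKernel.x w z τ) u ∧
      DifferentiableAt ℂ (fun ζ => CalogeroKernel.x u ζ τ) z ∧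
      DifferentiableAt ℂ (fun w => deriv (fun ζ => CalogeroKernel.x w ζ τ) z) u ∧
      DifferentiableAt ℂ (fun t => CalogeroKernel.x u z t) τ ∧
      2 * Real.pi * Complex.I * deriv (fun t => CalogeroKernel.x u z t) τ
        + deriv (fun w => deriv (fun ζ => CalogeroKernel.x w ζ τ) z) u = 0) := by
  exact ⟨fun _ _ _ hu hv huv hz => CalogeroKernel.x_mul_y_sub_y_mul_x hτ hu hv huv hz,
    fun _ _ hu hz => CalogeroKernel.x_mul_y_neg_sub_y_mul_x_neg hτ hu hz,
    fun _ _ hu hz => CalogeroKernel.x_mul_x_neg hτ hu hz,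
    fun u z hu hz => ⟨(CalogeroKernel.hasDerivAt_x_fst hτ z hu).differentiableAt,
      (CalogeroKernel.hasDerivAt_x_snd hτ u hz).differentiableAt,
      (CalogeroKernel.hasDerivAt_deriv_x hτ hu hz).differentiableAt,
      (CalogeroKernel.hasDerivAt_x_tau hτ hu hz).differentiableAt,
      CalogeroKernel.heat_equation hτ hu hz⟩⟩
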